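/- Conventions. Write $x\cdot y$ for the standard inner product, $\langle x\rangle=(1+|x|^2)^{1/2}$, $\mathcal F f(\xi)=\int f(t)e^{-2\pi i\xi\cdot t}\,dt$ (extended to tempered distributions), $\varphi(t)=e^{-\pi|t|^2}$ for $t\in\mathbb R^{2d}$, and $\Phi_M(t)=e^{i\pi Mt\cdot t}$ for a real symmetric matrix $M$. For $z=(x,\xi)\in\mathbb R^{2d}$ and $\tau\in\mathbb R$ let $\rho(z;\tau)f(t)=e^{2\pi i\tau}e^{-i\pi x\cdot\xi}e^{2\pi i\xi\cdot t}f(t-x)$ on $L^2(\mathbb R^d)$. A metaplectic operator with projection $S\in\mathrm{Sp}(d,\mathbb R)$ is a unitary operator $\hat S$ on $L^2(\mathbb R^d)$ with $\hat S\rho(z;\tau)\hat S^{-1}=\rho(Sz;\tau)$ for all $z,\tau$. A Schwartz kernel of $\hat S$ is a $k\in\mathcal S'(\mathbb R^{2d})$ with $\langle \hat Sf,g\rangle=\langle k,g\otimes f\rangle$ for all $f,g\in\mathcal S(\mathbb R^d)$ (bilinear pairings, $(g\otimes f)(x,y)=g(x)f(y)$; by the Schwartz kernel theorem there is exactly one).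 Its smoothed kernel is the function $\tilde k=k\ast\varphi$ on $\mathbb R^{2d}$. The kernel $k$ is called quasi-diagonal if $\tilde k$ is continuous and for every integer $N>0$ there is $C_N>0$ with $|\tilde k(x,y)|\le C_N\langle x-y\rangle^{-N}$ for all $x,y\in\mathbb R^d$. **Proposition 3.2.** Let $\hat S$ be a metaplectic operator on $L^2(\mathbb R^d)$ with projection $S=\begin{pmatrix}A&B\\ C&D\end{pmatrix}\in\mathrm{Sp}(d,\mathbb R)$, where $A,B,C,D\in\mathbb R^{d\times d}$, and suppose that $C$ is invertible. Put $$\tilde S=\begin{pmatrix}AC^{-1}&C^{-T}\\ C^{-1}&C^{-1}D\end{pmatrix}.$$ Then there is $c\in\mathbb C$ with $|c|=1$ such that $c\,|\det C|^{-1/2}\,\mathcal F\Phi_{-\tilde S}\in\mathcal S'(\mathbb R^{2d})$ is a Schwartz kernel of $\hat S$ and such that every Schwartz kernel $k$ of $\hat S$ satisfies $$\tilde k=c\,|\det C|^{-1/2}\,\mathcal F(\Phi_{-\tilde S}\,\varphi)\quad\text{on }\mathbb R^{2d}.$$ Moreover $\tilde k\in\mathcal S(\mathbb R^{2d})$; in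 particular, $k$ is quasi-diagonal. -/

import Mathlib

open scoped SchwartzMap FourierTransform ENNReal Nat
open MeasureTheory

noncomputable section

namespace Metaplectic

/-- The Euclidean space `ℝ^d`. -/
abbrev Rd (d : ℕ) : Type := EuclideanSpace ℝ (Fin d)

/-- The Euclidean space `ℝ^{2d} = ℝ^d × ℝ^d`; the first block of coordinates is indexed by
`Sum.inl`, the second one by `Sum.inr`. -/
abbrev R2d (d : ℕ) : Type := EuclideanSpace ℝ (Fin d ⊕ Fin d)

variable {d : ℕ}

/-- The point `(x, y)` of `ℝ^{2d}`. -/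
def pair (x y : Rd d) : R2d d := WithLp.toLp 2 (Sum.elim x.ofLp y.ofLp)

/-- The projection `(x, y) ↦ x`. -/
def fstL (d : ℕ) : R2d d →L[ℝ] Rd d :=
  LinearMap.toContinuousLinearMap
    { toFun := fun z => WithLp.toLp 2 (fun i => z (Sum.inl i))
      map_add' := fun _ _ => rfl
      map_smul' := fun _ _ => rfl }

/-- The projection `(x, y) ↦ y`. -/
def sndL (d : ℕ) : R2d d →L[ℝ] Rd d :=
  LinearMap.toContinuousLinearMap
    { toFun := fun z => WithLp.toLp 2 (fun i => z (Sum.inr i))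
      map_add' := fun _ _ => rfl
      map_smul' := fun _ _ => rfl }

@[simp] theorem fstL_pair (x y : Rd d) : fstL d (pair x y) = x := rfl

@[simp] theorem sndL_pair (x y : Rd d) : sndL d (pair x y) = y := rfl

theorem norm_sq_eq (z : R2d d) : ‖z‖ ^ 2 = ‖fstL d z‖ ^ 2 + ‖sndL d z‖ ^ 2 := by
  simp only [EuclideanSpace.norm_sq_eq, Fintype.sum_sum_type]
  rfl

theorem norm_le_add (z : R2d d) : ‖z‖ ≤ ‖fstL d z‖ + ‖sndL d z‖ := by
  have h := norm_sq_eq z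
  nlinarith [norm_nonneg z, norm_nonneg (fstL d z), norm_nonneg (sndL d z),
    mul_nonneg (norm_nonneg (fstL d z)) (norm_nonneg (sndL d z))]

theorem norm_fstL_le : ‖fstL d‖ ≤ 1 := by
  refine ContinuousLinearMap.opNorm_le_bound _ zero_le_one fun z => ?_
  have h := norm_sq_eq z
  nlinarith [norm_nonneg z, norm_nonneg (fstL d z), sq_nonneg (‖sndL d z‖)]

theorem norm_sndL_le : ‖sndL d‖ ≤ 1 := by
  refine ContinuousLinearMap.opNorm_le_bound _ zero_le_one fun z => ?_
  have h := norm_sq_eq z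
  nlinarith [norm_nonneg z, norm_nonneg (sndL d z), sq_nonneg (‖fstL d z‖)]

/-! ### Schwartz functions: tensor products and the Gaussian -/

theorem norm_iteratedFDeriv_comp_clm_le {V W : Type*} [NormedAddCommGroup V] [NormedSpace ℝ V]
    [NormedAddCommGroup W] [NormedSpace ℝ W] (L : V →L[ℝ] W) (hL : ‖L‖ ≤ 1)
    (f : 𝓢(W, ℂ)) (n : ℕ) (z : V) :
    ‖iteratedFDeriv ℝ n (fun z => f (L z)) z‖ ≤ ‖iteratedFDeriv ℝ n f (L z)‖ := by
  have h := L.iteratedFDeriv_comp_right (f.smooth ⊤) z (i := n) (by exact_mod_cast le_top)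
  change ‖iteratedFDeriv ℝ n (f ∘ L) z‖ ≤ _
  rw [h]
  refine (ContinuousMultilinearMap.norm_compContinuousLinearMap_le _ _).trans ?_
  refine mul_le_of_le_one_right (norm_nonneg _) ?_
  exact Finset.prod_le_one (fun _ _ => norm_nonneg _) (fun _ _ => hL)

/-- The tensor product `(g ⊗ f)(x, y) = g(x) f(y)` of two Schwartz functions. -/
def tensor (g f : 𝓢(Rd d, ℂ)) : 𝓢(R2d d, ℂ) where
  toFun z := g (fstL d z) * f (sndL d z)
  smooth' := ((g.smooth ⊤).comp (fstL d).contDiff).mul ((f.smooth ⊤).comp (sndL d).contDiff)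
  decay' := by
    intro k n
    have hb : ∀ h : 𝓢(Rd d, ℂ), ∃ M : ℝ, 0 ≤ M ∧
        ∀ i ≤ n, ∀ x, (1 + ‖x‖) ^ k * ‖iteratedFDeriv ℝ i h x‖ ≤ M := by
      intro h
      refine ⟨2 ^ k * (Finset.Iic (k, n)).sup (fun m => SchwartzMap.seminorm ℝ m.1 m.2) h,
        by positivity, fun i hi x => ?_⟩
      exact SchwartzMap.one_add_le_sup_seminorm_apply (𝕜 := ℝ) (m := (k, n)) le_rfl hi h x
    obtain ⟨M, hM0, hM⟩ := hb g
    obtain ⟨N, hN0, hN⟩ := hb f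
    refine ⟨∑ i ∈ Finset.range (n + 1), (n.choose i : ℝ) * (M * N), fun z => ?_⟩
    have hG : ContDiff ℝ ((⊤ : ℕ∞) : WithTop ℕ∞) (fun z : R2d d => g (fstL d z)) :=
      (g.smooth ⊤).comp (fstL d).contDiff
    have hF : ContDiff ℝ ((⊤ : ℕ∞) : WithTop ℕ∞) (fun z : R2d d => f (sndL d z)) :=
      (f.smooth ⊤).comp (sndL d).contDiff
    have h1 := norm_iteratedFDeriv_mul_le hG hF z (n := n) (by exact_mod_cast le_top)
    have hz : ‖z‖ ^ k ≤ (1 + ‖fstL d z‖) ^ k * (1 + ‖sndL d z‖) ^ k := by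
      rw [← mul_pow]
      refine pow_le_pow_left₀ (norm_nonneg _) ((norm_le_add z).trans ?_) k
      nlinarith [mul_nonneg (norm_nonneg (fstL d z)) (norm_nonneg (sndL d z))]
    calc ‖z‖ ^ k * ‖iteratedFDeriv ℝ n (fun z => g (fstL d z) * f (sndL d z)) z‖
        ≤ ((1 + ‖fstL d z‖) ^ k * (1 + ‖sndL d z‖) ^ k) *
            ∑ i ∈ Finset.range (n + 1), (n.choose i : ℝ) *
              ‖iteratedFDeriv ℝ i (fun z : R2d d => g (fstL d z)) z‖ *
              ‖iteratedFDeriv ℝ (n - i) (fun z : R2d d => f (sndL d z)) z‖ := by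
          gcongr
      _ ≤ _ := by
          rw [Finset.mul_sum]
          refine Finset.sum_le_sum fun i hi => ?_
          have hi' : i ≤ n := Nat.lt_succ_iff.mp (Finset.mem_range.mp hi)
          have e1 := norm_iteratedFDeriv_comp_clm_le (fstL d) norm_fstL_le g i z
          have e2 := norm_iteratedFDeriv_comp_clm_le (sndL d) norm_sndL_le f (n - i) z
          have b1 : (1 + ‖fstL d z‖) ^ k *
              ‖iteratedFDeriv ℝ i (fun z : R2d d => g (fstL d z)) z‖ ≤ M :=
            (mul_le_mul_of_nonneg_left e1 (by positivity)).trans (hM i hi' _)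
          have b2 : (1 + ‖sndL d z‖) ^ k *
              ‖iteratedFDeriv ℝ (n - i) (fun z : R2d d => f (sndL d z)) z‖ ≤ N :=
            (mul_le_mul_of_nonneg_left e2 (by positivity)).trans (hN (n - i) (Nat.sub_le _ _) _)
          have b3 := mul_le_mul b1 b2 (by positivity) hM0
          have b4 := mul_le_mul_of_nonneg_left b3 (Nat.cast_nonneg (α := ℝ) (n.choose i))
          refine le_trans (le_of_eq ?_) b4
          ring

@[simp] theorem tensor_apply (g f : 𝓢(Rd d, ℂ)) (z : R2d d) :
    tensor g f z = g (fstL d z) * f (sndL d z) := rfl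

theorem one_add_pow_mul_exp_le (m : ℕ) (r : ℝ) (hr : 0 ≤ r) :
    (1 + r) ^ m * Real.exp (-Real.pi * r ^ 2) ≤ m ! * Real.exp 2 := by
  have h1 : (1 + r) ^ m ≤ m ! * Real.exp (1 + r) := by
    have := Real.pow_div_factorial_le_exp (1 + r) (by linarith) m
    rw [div_le_iff₀ (by positivity)] at this
    linarith
  calc (1 + r) ^ m * Real.exp (-Real.pi * r ^ 2)
      ≤ m ! * Real.exp (1 + r) * Real.exp (-Real.pi * r ^ 2) := by gcongr
    _ = m ! * Real.exp (1 + r + -Real.pi * r ^ 2) := by rw [mul_assoc, ← Real.exp_add]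
    _ ≤ m ! * Real.exp 2 := by
        gcongr
        nlinarith [Real.pi_gt_three, sq_nonneg (r - 1), sq_nonneg r]

/-- The Gaussian `t ↦ exp (-π |t|²)` as a real-valued Schwartz function. -/
def gaussianReal (V : Type*) [NormedAddCommGroup V] [InnerProductSpace ℝ V] : 𝓢(V, ℝ) where
  toFun t := Real.exp (-Real.pi * ‖t‖ ^ 2)
  smooth' := Real.contDiff_exp.comp (contDiff_const.mul (contDiff_norm_sq ℝ))
  decay' := by
    intro p n
    obtain ⟨k, C, hC, hb⟩ :=
      (Function.hasTemperateGrowth_norm_sq (H := V)).norm_iteratedFDeriv_le_uniform n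
    refine ⟨n ! * Real.pi ^ n * (1 + C) ^ n * ((p + k * n) ! * Real.exp 2) + 0, fun x => ?_⟩
    have h1 := norm_iteratedFDeriv_comp_le (n := n) (N := ((⊤ : ℕ∞) : WithTop ℕ∞))
      (g := fun s : ℝ => Real.exp (-Real.pi * s)) (f := fun t : V => ‖t‖ ^ 2)
      (Real.contDiff_exp.comp (contDiff_const.mul contDiff_id)) (contDiff_norm_sq ℝ)
      (by exact_mod_cast le_top) x
      (C := Real.pi ^ n * Real.exp (-Real.pi * ‖x‖ ^ 2)) (D := (1 + C) * (1 + ‖x‖) ^ k)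
      (by
        intro i hi
        rw [norm_iteratedFDeriv_eq_norm_iteratedDeriv, iteratedDeriv_exp_const_mul]
        simp only [norm_mul, norm_pow, norm_neg, Real.norm_eq_abs, abs_of_pos Real.pi_pos,
          Real.abs_exp]
        gcongr
        linarith [Real.pi_gt_three])
      (by
        intro i h1i hi
        have h2 : (1 : ℝ) ≤ (1 + ‖x‖) ^ k := one_le_pow₀ (by linarith [norm_nonneg x])
        calc _ ≤ C * (1 + ‖x‖) ^ k := hb i hi x
          _ ≤ (1 + C) * (1 + ‖x‖) ^ k := by nlinarith
          _ ≤ _ := le_self_pow₀ (by nlinarith) (by omega))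
    have h3 := one_add_pow_mul_exp_le (p + k * n) ‖x‖ (norm_nonneg x)
    have h4 : ‖x‖ ^ p ≤ (1 + ‖x‖) ^ p := by
      gcongr
      linarith
    change ‖x‖ ^ p * ‖iteratedFDeriv ℝ n
      ((fun s : ℝ => Real.exp (-Real.pi * s)) ∘ (fun t : V => ‖t‖ ^ 2)) x‖ ≤ _
    calc _ ≤ (1 + ‖x‖) ^ p * (n ! * (Real.pi ^ n * Real.exp (-Real.pi * ‖x‖ ^ 2)) *
          ((1 + C) * (1 + ‖x‖) ^ k) ^ n) := by gcongr
      _ = n ! * Real.pi ^ n * (1 + C) ^ n *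
          ((1 + ‖x‖) ^ (p + k * n) * Real.exp (-Real.pi * ‖x‖ ^ 2)) := by
        rw [mul_pow, ← pow_mul, pow_add]
        ring
      _ ≤ n ! * Real.pi ^ n * (1 + C) ^ n * ((p + k * n) ! * Real.exp 2) := by gcongr
      _ = _ := by ring

/-- The Gaussian `φ(t) = exp (-π |t|²)` as a (complex-valued) Schwartz function. -/
def gaussian (V : Type*) [NormedAddCommGroup V] [InnerProductSpace ℝ V] : 𝓢(V, ℂ) :=
  SchwartzMap.postcompCLM (𝕜 := ℝ) Complex.ofRealCLM (gaussianReal V)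

@[simp] theorem gaussian_apply {V : Type*} [NormedAddCommGroup V] [InnerProductSpace ℝ V] (t : V) :
    gaussian V t = ((Real.exp (-Real.pi * ‖t‖ ^ 2) : ℝ) : ℂ) := rfl

/-! ### The Schrödinger representation and metaplectic operators -/

/-- The Hilbert space `L²(ℝ^d)`. -/
abbrev L2 (d : ℕ) : Type := Lp ℂ 2 (volume : Measure (Rd d))

/-- The function `t ↦ e^{2πiτ} e^{-iπ x·ξ} e^{2πi ξ·t} f(t - x)`, where `z = (x, ξ)`. -/
def schrodingerFun (z : R2d d) (τ : ℝ) (f : Rd d → ℂ) (t : Rd d) : ℂ :=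
  Complex.exp (2 * Real.pi * Complex.I * (τ : ℂ)) *
    Complex.exp (-(Complex.I * Real.pi * (inner ℝ (fstL d z) (sndL d z) : ℝ))) *
    Complex.exp (2 * Real.pi * Complex.I * (inner ℝ (sndL d z) t : ℝ)) * f (t - fstL d z)

theorem memLp_schrodingerFun (z : R2d d) (τ : ℝ) {f : Rd d → ℂ} (hf : MemLp f 2 volume) :
    MemLp (schrodingerFun z τ f) 2 volume := by
  have h1 : MemLp (fun t => f (t - fstL d z)) 2 volume :=
    hf.comp_measurePreserving (measurePreserving_sub_right volume (fstL d z))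
  refine MemLp.of_le h1 ?_ (Filter.Eventually.of_forall fun t => ?_)
  · refine AEStronglyMeasurable.mul (Continuous.aestronglyMeasurable ?_) h1.1
    fun_prop
  · have e1 : ‖Complex.exp (2 * Real.pi * Complex.I * (τ : ℂ))‖ = 1 := by
      rw [Complex.norm_exp]; simp
    have e2 : ‖Complex.exp (-(Complex.I * Real.pi * (inner ℝ (fstL d z) (sndL d z) : ℝ)))‖
        = 1 := by
      rw [Complex.norm_exp]; simp
    have e3 : ‖Complex.exp (2 * Real.pi * Complex.I * (inner ℝ (sndL d z) t : ℝ))‖ = 1 := by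
      rw [Complex.norm_exp]; simp
    simp only [schrodingerFun, norm_mul, e1, e2, e3, one_mul, le_refl]

/-- The Schrödinger representation `ρ(x, ξ; τ)` on `L²(ℝ^d)`, with `z = (x, ξ)`:
`ρ(x, ξ; τ) f(t) = e^{2πiτ} e^{-iπ x·ξ} e^{2πi ξ·t} f(t - x)`. -/
def schrodinger (z : R2d d) (τ : ℝ) (f : L2 d) : L2 d :=
  (memLp_schrodingerFun z τ (Lp.memLp f)).toLp

/-- `T` is a metaplectic operator with projection `S`: it is a unitary operator on `L²(ℝ^d)` with
`T ρ(z; τ) T⁻¹ = ρ(S z; τ)` for all `z ∈ ℝ^{2d}` and `τ ∈ ℝ`, where `S` is symplectic. -/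
structure IsMetaplectic (S : Matrix (Fin d ⊕ Fin d) (Fin d ⊕ Fin d) ℝ)
    (T : L2 d ≃ₗᵢ[ℂ] L2 d) : Prop where
  symplectic : S ∈ Matrix.symplecticGroup (Fin d) ℝ
  intertwines : ∀ (z : R2d d) (τ : ℝ) (f : L2 d),
    T (schrodinger z τ (T.symm f)) = schrodinger (S.toEuclideanLin z) τ f

/-! ### Schwartz kernels -/

/-- The operator `𝓢(ℝ^d) → 𝓢'(ℝ^d)` induced by an operator on `L²(ℝ^d)`. -/
def onSchwartz (T : L2 d ≃ₗᵢ[ℂ] L2 d) (f : 𝓢(Rd d, ℂ)) : 𝓢'(Rd d, ℂ) :=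
  Lp.toTemperedDistribution (T (f.toLp 2 volume))

/-- `k ∈ 𝓢'(ℝ^{2d})` is the Schwartz kernel of `T : 𝓢(ℝ^d) → 𝓢'(ℝ^d)`, that is,
`T f (x) = ∫ k(x, y) f(y) dy` in the sense that `⟨T f, g⟩ = ⟨k, g ⊗ f⟩` for all `f`, `g`
(bilinear pairings). -/
def IsSchwartzKernel (T : 𝓢(Rd d, ℂ) → 𝓢'(Rd d, ℂ)) (k : 𝓢'(R2d d, ℂ)) : Prop :=
  ∀ f g : 𝓢(Rd d, ℂ), T f g = k (tensor g f)

/-- For a Schwartz function `ψ`, the Schwartz function `t ↦ ψ(z - t)`. -/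
def reflectTranslate {V : Type*} [NormedAddCommGroup V] [NormedSpace ℝ V] (ψ : 𝓢(V, ℂ)) (z : V) :
    𝓢(V, ℂ) :=
  SchwartzMap.compSubConstCLM ℂ z
    (SchwartzMap.compCLMOfContinuousLinearEquiv ℂ (ContinuousLinearEquiv.neg ℝ) ψ)

@[simp] theorem reflectTranslate_apply {V : Type*} [NormedAddCommGroup V] [NormedSpace ℝ V]
    (ψ : 𝓢(V, ℂ)) (z t : V) : reflectTranslate ψ z t = ψ (z - t) := by
  simp [reflectTranslate]

/-- The convolution `(k ∗ ψ)(z) = ⟨k, ψ(z - ·)⟩` of `k ∈ 𝓢'` with `ψ ∈ 𝓢`. -/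
def convolve (k : 𝓢'(R2d d, ℂ)) (ψ : 𝓢(R2d d, ℂ)) (z : R2d d) : ℂ :=
  k (reflectTranslate ψ z)

/-- The smoothed kernel `k̃ = k ∗ φ`, where `φ` is the Gaussian on `ℝ^{2d}`. -/
def smoothedKernel (k : 𝓢'(R2d d, ℂ)) : R2d d → ℂ := convolve k (gaussian (R2d d))

/-- The bracket `⟨x⟩ = (1 + |x|²)^{1/2}`. -/
def bracket (x : Rd d) : ℝ := Real.sqrt (1 + ‖x‖ ^ 2)

/-- A continuous function `K` on `ℝ^{2d}` is a diagonal kernel if `|K(x, y)| ≤ C_N ⟨x - y⟩^{-N}`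
for every integer `N > 0`. -/
def IsDiagonalKernel (K : R2d d → ℂ) : Prop :=
  Continuous K ∧ ∀ N : ℕ, 0 < N → ∃ C : ℝ, 0 < C ∧
    ∀ x y : Rd d, ‖K (pair x y)‖ ≤ C * (bracket (x - y) ^ N)⁻¹

/-- `k` is quasi-diagonal if its smoothed kernel is a diagonal kernel. -/
def IsQuasiDiagonal (k : 𝓢'(R2d d, ℂ)) : Prop := IsDiagonalKernel (smoothedKernel k)

/-! ### Chirps -/

/-- The chirp `Φ_M(t) = e^{iπ M t · t}`. -/
def chirp (M : Matrix (Fin d ⊕ Fin d) (Fin d ⊕ Fin d) ℝ) (t : R2d d) : ℂ :=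
  Complex.exp (Complex.I * Real.pi * (inner ℝ (M.toEuclideanLin t) t : ℝ))

theorem norm_chirp (M : Matrix (Fin d ⊕ Fin d) (Fin d ⊕ Fin d) ℝ) (t : R2d d) :
    ‖chirp M t‖ = 1 := by
  rw [chirp, Complex.norm_exp]; simp

theorem memLp_chirp (M : Matrix (Fin d ⊕ Fin d) (Fin d ⊕ Fin d) ℝ) :
    MemLp (chirp M) ∞ (volume : Measure (R2d d)) := by
  refine memLp_top_of_bound (Continuous.aestronglyMeasurable ?_) 1
    (Filter.Eventually.of_forall fun t => (norm_chirp M t).le)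
  have h : Continuous fun t : R2d d => M.toEuclideanLin t :=
    LinearMap.continuous_of_finiteDimensional _
  unfold chirp
  fun_prop

/-- The chirp `Φ_M` as a tempered distribution, `⟨Φ_M, g⟩ = ∫ Φ_M(t) g(t) dt`. -/
def chirpDistribution (M : Matrix (Fin d ⊕ Fin d) (Fin d ⊕ Fin d) ℝ) : 𝓢'(R2d d, ℂ) :=
  Lp.toTemperedDistribution (memLp_chirp M).toLp

/-- For `S = (A B; C D)` with `C` invertible, the matrix `S̃ = (A C⁻¹, C⁻ᵀ; C⁻¹, C⁻¹ D)`. -/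
def chirpMatrix (A C D : Matrix (Fin d) (Fin d) ℝ) : Matrix (Fin d ⊕ Fin d) (Fin d ⊕ Fin d) ℝ :=
  Matrix.fromBlocks (A * C⁻¹) (C⁻¹).transpose C⁻¹ (C⁻¹ * D)

end Metaplectic

end

/-! By Schur's lemma, a unitary operator that intertwines the Schrödinger representation with its
composition by `S` is unique up to a phase. It therefore suffices to exhibit one explicit operator
with that intertwining property, and to compute its kernel.

Since `C` is invertible, `S` factors into elementary symplectic maps. Correspondingly, `blockModel`
is the composition 𝓕 Φ_{-AC⁻¹} (· ∘ C⁻¹) 𝓕 Φ_{-C⁻¹D} 𝓕, which preserves Schwartz functions. Each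
factor acts on time-frequency shifts by a known linear map, and the symplectic relations identify
the product with `S` (`blockModel_shift`). The factor |det C|^{-1/2} makes the model isometric, so
`exists_eq_smul_of_commute`, itself a consequence of `moyal`, gives T = c |det C|^{-1/2} · model on
Schwartz functions (`exists_apply_toLp_eq`).

For the kernel, the outer 𝓕 is moved onto g and the middle one is written as an integral. The
pairing of the model with g becomes ∬ Φ_{-S̃}(u,v) 𝓕g(u) 𝓕f(v) du dv, which is 𝓕Φ_{-S̃} tested on g
⊗ f (`fourier_chirpDistribution_tensor`).

A translated Gaussian on ℝ^{2d} is a tensor product, so the kernel identity alone determines the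
smoothed kernel, with no appeal to uniqueness of kernels. As 𝓕φ = φ, the smoothed kernel is the
Fourier transform of the Schwartz function Φ_{-S̃} φ, and Schwartz decay in (x,y) implies decay in x
- y. -/

namespace Metaplectic

/-! ### Phase factors, chirps and time-frequency shifts on Schwartz functions -/

/-- The phase `e^{iπs}`. -/
noncomputable def phase (s : ℝ) : ℂ := Complex.exp (Complex.I * Real.pi * (s : ℂ))

theorem phase_add (s t : ℝ) : phase (s + t) = phase s * phase t := by
  rw [phase, phase, phase, ← Complex.exp_add]
  push_cast
  ring_nf

@[simp] theorem phase_zero : phase 0 = 1 := by simp [phase]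

@[simp] theorem norm_phase (s : ℝ) : ‖phase s‖ = 1 := by
  rw [phase, Complex.norm_exp]
  simp

@[simp] theorem conj_phase (s : ℝ) : (starRingEnd ℂ) (phase s) = phase (-s) := by
  simp only [phase, ← Complex.exp_conj, map_mul, Complex.conj_I, Complex.conj_ofReal]
  push_cast
  ring_nf

theorem phase_neg_mul_phase (s : ℝ) : phase (-s) * phase s = 1 := by
  rw [← phase_add]
  simp

theorem iteratedDeriv_phase (n : ℕ) :
    iteratedDeriv n phase = fun s => (Complex.I * Real.pi) ^ n * phase s := by
  induction n with
  | zero => simp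
  | succ n ih =>
    rw [iteratedDeriv_succ, ih]
    ext s
    have h1 : HasDerivAt phase (phase s * (Complex.I * Real.pi * 1)) s :=
      ((Complex.ofRealCLM.hasDerivAt (x := s)).const_mul (Complex.I * Real.pi)).cexp
    rw [(h1.const_mul _).deriv, pow_succ]
    ring

theorem contDiff_phase {n : WithTop ℕ∞} : ContDiff ℝ n phase :=
  (contDiff_const.mul Complex.ofRealCLM.contDiff).cexp

theorem hasTemperateGrowth_phase : phase.HasTemperateGrowth := by
  -- All derivatives are bounded, so growth exponent 0 suffices.
  refine ⟨contDiff_phase, fun n => ⟨0, Real.pi ^ n, fun s => ?_⟩⟩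
  rw [norm_iteratedFDeriv_eq_norm_iteratedDeriv, iteratedDeriv_phase]
  simp [abs_of_pos Real.pi_pos]

section Operators

variable {V : Type*} [NormedAddCommGroup V] [InnerProductSpace ℝ V]

/-- The quadratic form `t ↦ L t · t` attached to a continuous linear map. -/
def quad (L : V →L[ℝ] V) (t : V) : ℝ := inner ℝ (L t) t

theorem hasTemperateGrowth_phase_quad (L : V →L[ℝ] V) :
    (fun t => phase (quad L t)).HasTemperateGrowth :=
  hasTemperateGrowth_phase.comp
    ((innerSL ℝ).bilinear_hasTemperateGrowth L.hasTemperateGrowth .id')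

theorem hasTemperateGrowth_phase_inner (ξ : V) :
    (fun t => phase (2 * inner ℝ ξ t)).HasTemperateGrowth :=
  hasTemperateGrowth_phase.comp (f := fun t => 2 * inner ℝ ξ t)
    ((Function.HasTemperateGrowth.const 2).mul (innerSL ℝ ξ).hasTemperateGrowth)

/-- Multiplication of Schwartz functions by the chirp `e^{iπ L t · t}`. -/
noncomputable def chirpMul (L : V →L[ℝ] V) : 𝓢(V, ℂ) →L[ℂ] 𝓢(V, ℂ) :=
  SchwartzMap.smulLeftCLM ℂ (fun t => phase (quad L t))

@[simp] theorem chirpMul_apply (L : V →L[ℝ] V) (f : 𝓢(V, ℂ)) (t : V) :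
    chirpMul L f t = phase (quad L t) * f t := by
  rw [chirpMul, SchwartzMap.smulLeftCLM_apply_apply (hasTemperateGrowth_phase_quad L),
    smul_eq_mul]

/-- The time-frequency shift `f ↦ e^{-iπ x·ξ} e^{2πi ξ·t} f(t - x)` of Schwartz functions. -/
noncomputable def shift (x ξ : V) : 𝓢(V, ℂ) →L[ℂ] 𝓢(V, ℂ) :=
  phase (-inner ℝ x ξ) • (SchwartzMap.smulLeftCLM ℂ (fun t => phase (2 * inner ℝ ξ t))).comp
    (SchwartzMap.compSubConstCLM ℂ x)

@[simp] theorem shift_apply (x ξ : V) (f : 𝓢(V, ℂ)) (t : V) :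
    shift x ξ f t = phase (-inner ℝ x ξ) * phase (2 * inner ℝ ξ t) * f (t - x) := by
  simp [shift, SchwartzMap.smulLeftCLM_apply_apply (hasTemperateGrowth_phase_inner ξ), mul_assoc]

/-- Completing the square: Lt·t = L(t-x)·(t-x) + 2Lx·t - Lx·x. The last term is exactly the change
in the symmetric normalisation e^{-iπx·ξ}, so no stray phase remains. The chirp thus acts on phase
space as the shear (x, ξ) ↦ (x, ξ + Lx). -/
theorem chirpMul_shift {L : V →L[ℝ] V} (hL : ∀ s t, inner ℝ (L s) t = inner ℝ (L t) s)
    (x ξ : V) (f : 𝓢(V, ℂ)) :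
    chirpMul L (shift x ξ f) = shift x (ξ + L x) (chirpMul L f) := by
  ext t
  simp only [chirpMul_apply, shift_apply, ← mul_assoc, ← phase_add]
  congr 2
  simp only [quad, map_sub, inner_sub_left, inner_sub_right, inner_add_left, inner_add_right,
    hL t x, real_inner_comm x (L x)]
  ring

/-- Composition of Schwartz functions with an invertible linear map. -/
noncomputable def dilation (e : V ≃L[ℝ] V) : 𝓢(V, ℂ) →L[ℂ] 𝓢(V, ℂ) :=
  SchwartzMap.compCLMOfContinuousLinearEquiv ℂ e

@[simp] theorem dilation_apply (e : V ≃L[ℝ] V) (f : 𝓢(V, ℂ)) (t : V) :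
    dilation e f t = f (e t) := rfl

theorem dilation_shift (e : V ≃L[ℝ] V) {x x' ξ ξ' : V} (hx : e x' = x)
    (hξ : ∀ t, inner ℝ ξ (e t) = inner ℝ ξ' t) (f : 𝓢(V, ℂ)) :
    dilation e (shift x ξ f) = shift x' ξ' (dilation e f) := by
  ext t
  have h : inner ℝ x ξ = inner ℝ x' ξ' := by
    rw [real_inner_comm, ← hx, hξ, real_inner_comm]
  simp [hξ, h, map_sub, hx]

/-! ### Fourier transform and L² inner products under the elementary operators. -/

variable [FiniteDimensional ℝ V] [MeasurableSpace V] [BorelSpace V]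

theorem fourier_apply_eq (f : V → ℂ) (w : V) :
    𝓕 f w = ∫ t, phase (-(2 * inner ℝ t w)) * f t := by
  rw [Real.fourier_eq']
  refine integral_congr_ae (.of_forall fun t => ?_)
  simp only [phase, smul_eq_mul]
  push_cast
  ring_nf

theorem fourier_shift (x ξ : V) (f : 𝓢(V, ℂ)) : 𝓕 (shift x ξ f) = shift ξ (-x) (𝓕 f) := by
  ext w
  rw [shift_apply, SchwartzMap.fourier_coe, SchwartzMap.fourier_coe, fourier_apply_eq,
    fourier_apply_eq, ← integral_add_right_eq_self _ x, ← integral_const_mul]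
  refine integral_congr_ae (.of_forall fun t => ?_)
  simp only [shift_apply, ← mul_assoc, ← phase_add, add_sub_cancel_right]
  congr 2
  simp only [inner_add_left, inner_add_right, inner_sub_right, inner_neg_left, inner_neg_right,
    real_inner_comm t ξ, real_inner_comm x ξ]
  ring

theorem inner_toLp_fourier (f g : 𝓢(V, ℂ)) :
    inner ℂ ((𝓕 f).toLp 2 volume) ((𝓕 g).toLp 2 volume) =
      inner ℂ (f.toLp 2 volume) (g.toLp 2 volume) :=
  SchwartzMap.inner_fourier_toL2_eq f g

theorem inner_toLp_chirpMul (L : V →L[ℝ] V) (f g : 𝓢(V, ℂ)) :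
    inner ℂ ((chirpMul L f).toLp 2 volume) ((chirpMul L g).toLp 2 volume) =
      inner ℂ (f.toLp 2 volume) (g.toLp 2 volume) := by
  simp only [SchwartzMap.inner_toL2_toL2_eq]
  refine integral_congr_ae (.of_forall fun t => ?_)
  simp only [chirpMul_apply, RCLike.inner_apply, map_mul, conj_phase]
  linear_combination (g t * (starRingEnd ℂ) (f t)) * phase_neg_mul_phase (quad L t)

theorem integral_comp_continuousLinearEquiv (e : V ≃L[ℝ] V) (f : V → ℂ) :
    ∫ t, f (e t) = (|LinearMap.det (e : V →ₗ[ℝ] V)|⁻¹ : ℝ) * ∫ t, f t := by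
  have h0 : LinearMap.det (e : V →ₗ[ℝ] V) ≠ 0 := e.toLinearEquiv.isUnit_det'.ne_zero
  have h := Measure.map_linearMap_addHaar_eq_smul_addHaar (volume : Measure V) h0
  have h2 := e.toHomeomorph.toMeasurableEquiv.measurableEmbedding.integral_map
    (μ := (volume : Measure V)) f
  have h3 : Measure.map e.toHomeomorph.toMeasurableEquiv (volume : Measure V) =
      Measure.map (e : V →ₗ[ℝ] V) volume := rfl
  rw [h3, h, integral_smul_measure, abs_inv, ENNReal.toReal_ofReal (by positivity)] at h2
  rw [← Complex.real_smul]
  exact h2.symm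

theorem inner_toLp_dilation (e : V ≃L[ℝ] V) (f g : 𝓢(V, ℂ)) :
    inner ℂ ((dilation e f).toLp 2 volume) ((dilation e g).toLp 2 volume) =
      (|LinearMap.det (e : V →ₗ[ℝ] V)|⁻¹ : ℝ) *
        inner ℂ (f.toLp 2 volume) (g.toLp 2 volume) := by
  simp only [SchwartzMap.inner_toL2_toL2_eq, dilation_apply]
  exact integral_comp_continuousLinearEquiv e fun t => inner ℂ (f t) (g t)

end Operators

/-! ### Moyal's identity and Schur's lemma for the Schrödinger representation -/

variable {d : ℕ}

theorem schrodingerFun_pair (x ξ : Rd d) (f : Rd d → ℂ) (t : Rd d) :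
    schrodingerFun (pair x ξ) 0 f t =
      phase (-inner ℝ x ξ) * phase (2 * inner ℝ ξ t) * f (t - x) := by
  simp only [schrodingerFun, phase, fstL_pair, sndL_pair]
  push_cast
  simp only [mul_zero, Complex.exp_zero, one_mul]
  ring_nf

theorem schrodinger_pair_ae (x ξ : Rd d) (f : L2 d) :
    schrodinger (pair x ξ) 0 f =ᵐ[volume] fun t =>
      phase (-inner ℝ x ξ) * phase (2 * inner ℝ ξ t) * f (t - x) := by
  refine (MemLp.coeFn_toLp _).trans (.of_forall fun t => ?_)
  exact schrodingerFun_pair x ξ f t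

theorem schrodinger_toLp (x ξ : Rd d) (f : 𝓢(Rd d, ℂ)) :
    schrodinger (pair x ξ) 0 (f.toLp 2 volume) = (shift x ξ f).toLp 2 volume := by
  refine Lp.ext ?_
  have h1 := (measurePreserving_sub_right (volume : Measure (Rd d)) x).quasiMeasurePreserving.ae
    (f.coeFn_toLp 2 volume)
  filter_upwards [schrodinger_pair_ae x ξ (f.toLp 2 volume), (shift x ξ f).coeFn_toLp 2 volume, h1]
    with t h2 h3 h4
  rw [h2, h3, shift_apply, h4]

/-- The function `t ↦ conj (g (t - x)) f t`, whose Fourier transform is the short-time Fourier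
transform of `f` with window `g`. -/
noncomputable def windowed (g f : Rd d → ℂ) (x t : Rd d) : ℂ :=
  (starRingEnd ℂ) (g (t - x)) * f t

theorem integrable_conj_mul {f g : Rd d → ℂ} (hf : MemLp f 2 volume) (hg : MemLp g 2 volume) :
    Integrable fun t => (starRingEnd ℂ) (g t) * f t :=
  hg.star.integrable_mul hf

theorem integrable_windowed {f g : Rd d → ℂ} (hf : MemLp f 2 volume) (hg : MemLp g 2 volume)
    (x : Rd d) : Integrable (windowed g f x) :=
  integrable_conj_mul hf
    (hg.comp_measurePreserving (measurePreserving_sub_right (volume : Measure (Rd d)) x))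

theorem inner_schrodinger (f g : L2 d) (x ξ : Rd d) :
    inner ℂ (schrodinger (pair x ξ) 0 g) f = phase (inner ℝ x ξ) * 𝓕 (windowed g f x) ξ := by
  rw [fourier_apply_eq, ← integral_const_mul]
  refine integral_congr_ae ?_
  filter_upwards [schrodinger_pair_ae x ξ g] with t ht
  simp only [ht, RCLike.inner_apply, map_mul, conj_phase, neg_neg, windowed, real_inner_comm ξ t]
  ring

/-- Parseval with one factor merely integrable: the transform is moved off b onto 𝓕 a, where it
becomes the inverse transform and returns a. This generality is what `moyal` needs, since a product
of two L² functions is only known to be in L¹. -/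
theorem integral_conj_fourier_mul_fourier {b : Rd d → ℂ} (hb : Integrable b)
    (a : 𝓢(Rd d, ℂ)) :
    ∫ ξ, (starRingEnd ℂ) (𝓕 b ξ) * 𝓕 a ξ = ∫ t, (starRingEnd ℂ) (b t) * a t := by
  have h := VectorFourier.integral_sesq_fourierIntegral_eq_neg_flip (innerSL ℂ)
    (L := innerₗ (Rd d)) (μ := volume) (ν := volume) Real.continuous_fourierChar continuous_inner
    hb (𝓕 a).integrable
  have h2 : ∀ t, VectorFourier.fourierIntegral Real.fourierChar volume (-(innerₗ (Rd d)).flip)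
      (𝓕 a : 𝓢(Rd d, ℂ)) t = a t := by
    intro t
    have h3 : (𝓕⁻ (𝓕 a) : 𝓢(Rd d, ℂ)) t = a t := by rw [FourierTransform.fourierInv_fourier_eq]
    rw [← h3, SchwartzMap.fourierInv_coe, Real.fourierInv_eq]
    simp [VectorFourier.fourierIntegral, real_inner_comm]
  simp only [h2] at h
  simp only [innerSL_apply_apply, RCLike.inner_apply] at h
  simp only [mul_comm ((starRingEnd ℂ) _)]
  exact h

/-- For Schwartz functions `f` and `g`, the function `t ↦ conj (g (t - x)) f t` is Schwartz. -/
theorem exists_schwartz_windowed (f g : 𝓢(Rd d, ℂ)) (x : Rd d) :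
    ∃ a : 𝓢(Rd d, ℂ), ∀ t, a t = windowed g f x t := by
  refine ⟨SchwartzMap.pairing (ContinuousLinearMap.mul ℝ ℂ)
    (SchwartzMap.postcompCLM (𝕜 := ℝ) (Complex.conjCLE : ℂ →L[ℝ] ℂ)
      (SchwartzMap.compSubConstCLM ℝ x g)) f, fun t => ?_⟩
  simp [windowed]

theorem windowed_congr {f f' g g' : Rd d → ℂ} (hf : f =ᵐ[volume] f') (hg : g =ᵐ[volume] g')
    (x : Rd d) : windowed g f x =ᵐ[volume] windowed g' f' x := by
  have h1 := (measurePreserving_sub_right (volume : Measure (Rd d)) x).quasiMeasurePreserving.ae hg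
  filter_upwards [hf, h1] with t h2 h3
  rw [windowed, windowed, h2, h3]

/-- Moyal's identity, with the integral over phase space written as an iterated one. -/
theorem moyal (f g : 𝓢(Rd d, ℂ)) (h k : L2 d) :
    ∫ x, ∫ ξ, (starRingEnd ℂ) (inner ℂ (schrodinger (pair x ξ) 0 h) k) *
        inner ℂ (schrodinger (pair x ξ) 0 (g.toLp 2 volume)) (f.toLp 2 volume) =
      inner ℂ k (f.toLp 2 volume) * inner ℂ (g.toLp 2 volume) h := by
  set F : L2 d := f.toLp 2 volume
  set G : L2 d := g.toLp 2 volume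
  -- For fixed x the ξ-integral is a Parseval pairing; the phases e^{±iπx·ξ} cancel.
  have h1 : ∀ x, ∫ ξ, (starRingEnd ℂ) (inner ℂ (schrodinger (pair x ξ) 0 h) k) *
      inner ℂ (schrodinger (pair x ξ) 0 G) F =
      ∫ t, (starRingEnd ℂ) (windowed h k x t) * windowed G F x t := by
    intro x
    obtain ⟨a, ha⟩ := exists_schwartz_windowed f g x
    have hGF : windowed G F x =ᵐ[volume] a :=
      (windowed_congr (f.coeFn_toLp 2 volume) (g.coeFn_toLp 2 volume) x).trans
        (.of_forall fun t => (ha t).symm)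
    have h2 : 𝓕 (windowed G F x) = 𝓕 (a : Rd d → ℂ) := by
      ext ξ
      rw [fourier_apply_eq, fourier_apply_eq]
      refine integral_congr_ae ?_
      filter_upwards [hGF] with t ht
      rw [ht]
    have h3 := integral_conj_fourier_mul_fourier
      (integrable_windowed (Lp.memLp k) (Lp.memLp h) x) a
    have h4 : ∫ t, (starRingEnd ℂ) (windowed h k x t) * windowed G F x t =
        ∫ t, (starRingEnd ℂ) (windowed h k x t) * a t := by
      refine integral_congr_ae ?_
      filter_upwards [hGF] with t ht
      rw [ht]
    rw [h4, ← h3]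
    refine integral_congr_ae (.of_forall fun ξ => ?_)
    simp only [inner_schrodinger, map_mul, conj_phase, h2, SchwartzMap.fourier_coe]
    linear_combination ((starRingEnd ℂ) (𝓕 (windowed h k x) ξ) * 𝓕 (a : Rd d → ℂ) ξ) *
      phase_neg_mul_phase (inner ℝ x ξ)
  have hp : Integrable fun t => (starRingEnd ℂ) (k t) * F t :=
    integrable_conj_mul (Lp.memLp F) (Lp.memLp k)
  have hq : Integrable fun t => (starRingEnd ℂ) (G t) * h t :=
    integrable_conj_mul (Lp.memLp h) (Lp.memLp G)
  -- What remains is ∫∫ p(t) q(t - x) dt dx, the integral of the convolution of p with the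
  -- reflection of q, hence (∫ p)(∫ q).
  have h4 := integral_convolution (μ := (volume : Measure (Rd d))) (ContinuousLinearMap.mul ℝ ℂ)
    hp hq.comp_neg
  simp only [convolution, ContinuousLinearMap.mul_apply', neg_sub] at h4
  rw [integral_neg_eq_self (fun t => (starRingEnd ℂ) (G t) * h t) volume] at h4
  have h5 : ∀ u v : L2 d, inner ℂ u v = ∫ t, (starRingEnd ℂ) (u t) * v t := by
    intro u v
    refine integral_congr_ae (.of_forall fun t => ?_)
    simp [RCLike.inner_apply, mul_comm]
  rw [h5 k F, h5 G h, ← h4]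
  refine integral_congr_ae (.of_forall fun x => (h1 x).trans ?_)
  refine integral_congr_ae (.of_forall fun t => ?_)
  simp only [windowed, map_mul, Complex.conj_conj]
  ring

theorem norm_toLp_gaussian_pos :
    0 < ‖(gaussian (Rd d)).toLp 2 volume‖ := by
  rw [norm_pos_iff]
  intro h
  have h1 : gaussian (Rd d) = 0 := by
    refine SchwartzMap.injective_toLp 2 volume ?_
    simp only [h]
    exact ((SchwartzMap.toLpCLM ℂ ℂ 2 (volume : Measure (Rd d))).map_zero).symm
  have h2 : gaussian (Rd d) 0 = 0 := by rw [h1]; rfl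
  simp at h2

/-- Schur's lemma: an `L²`-isometric map on Schwartz functions that commutes with the
Schrödinger representation is multiplication by a number of modulus one. -/
theorem exists_eq_smul_of_commute (U : 𝓢(Rd d, ℂ) → L2 d)
    (hU : ∀ f g, inner ℂ (U f) (U g) = inner ℂ (f.toLp 2 volume) (g.toLp 2 volume))
    (hcomm : ∀ x ξ f, U (shift x ξ f) = schrodinger (pair x ξ) 0 (U f)) :
    ∃ γ : ℂ, ‖γ‖ = 1 ∧ ∀ f, U f = γ • f.toLp 2 volume := by
  set ψ := gaussian (Rd d)
  set Φ : L2 d := ψ.toLp 2 volume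
  have hΦ : 0 < ‖Φ‖ := norm_toLp_gaussian_pos
  -- The coefficients ⟨ρ(z) Uψ, Uk⟩ and ⟨ρ(z) ψ, k⟩ agree because U commutes with ρ and preserves
  -- inner products. Hence the left sides of two instances of Moyal's identity coincide, and
  -- comparing the right sides gives the claim.
  have h1 : ∀ f k : 𝓢(Rd d, ℂ), inner ℂ (U k) (f.toLp 2 volume) * inner ℂ Φ (U ψ) =
      inner ℂ (k.toLp 2 volume) (f.toLp 2 volume) * inner ℂ Φ Φ := by
    intro f k
    rw [← moyal f ψ (U ψ) (U k), ← moyal f ψ Φ (k.toLp 2 volume)]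
    simp only [← hcomm, hU, Φ, schrodinger_toLp]
  set a : ℂ := inner ℂ (U ψ) Φ
  have hconj : inner ℂ Φ (U ψ) = (starRingEnd ℂ) a := (inner_conj_symm _ _).symm
  -- Testing against the dense set of Schwartz functions f removes f. Linearity of U is never
  -- needed.
  have h2 : ∀ k : 𝓢(Rd d, ℂ), a • U k = (inner ℂ Φ Φ : ℂ) • k.toLp 2 volume := by
    intro k
    refine (SchwartzMap.denseRange_toLpCLM (F := ℂ) (p := 2)
      (μ := (volume : Measure (Rd d))) (by simp)).eq_of_inner_left ℂ fun f => ?_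
    rw [SchwartzMap.toLpCLM_apply, inner_smul_left, inner_smul_left, ← hconj, inner_conj_symm,
      mul_comm, h1, mul_comm]
  have hΦΦ : (inner ℂ Φ Φ : ℂ) ≠ 0 := by
    simpa [inner_self_eq_zero] using norm_pos_iff.mp hΦ
  have ha : a ≠ 0 := by
    intro ha
    have h3 := h2 ψ
    rw [ha, zero_smul] at h3
    exact (smul_ne_zero hΦΦ (norm_pos_iff.mp hΦ)) h3.symm
  have h4 : ∀ f, U f = (a⁻¹ * (inner ℂ Φ Φ : ℂ)) • f.toLp 2 volume := by
    intro f
    rw [mul_smul, ← h2, smul_smul, inv_mul_cancel₀ ha, one_smul]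
  refine ⟨_, ?_, h4⟩
  have h5 : ‖U ψ‖ = ‖Φ‖ := by
    rw [norm_eq_sqrt_re_inner (𝕜 := ℂ), hU, ← norm_eq_sqrt_re_inner]
  rw [h4 ψ, norm_smul] at h5
  exact mul_right_cancel₀ hΦ.ne' (h5.trans (one_mul _).symm)

/-! ### A model metaplectic operator on Schwartz functions -/

section Model

variable {V : Type*} [NormedAddCommGroup V] [InnerProductSpace ℝ V] [FiniteDimensional ℝ V]
  [MeasurableSpace V] [BorelSpace V]

/-- The operator `𝓕 Φ_Q (· ∘ e) 𝓕 Φ_P 𝓕` on Schwartz functions. -/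
noncomputable def model (P Q : V →L[ℝ] V) (e : V ≃L[ℝ] V) (f : 𝓢(V, ℂ)) : 𝓢(V, ℂ) :=
  𝓕 (chirpMul Q (dilation e (𝓕 (chirpMul P (𝓕 f)))))

/-- Follow (x, ξ) through the factors: 𝓕 gives (ξ, -x), the chirp (ξ, Pξ - x), 𝓕 again (Pξ - x, -ξ),
the dilation (e⁻¹(Pξ - x), -ξ'), then the shear by Q and a final rotation. Here ξ' is the transpose
of e applied to ξ. -/
theorem model_shift {P Q : V →L[ℝ] V} (hP : ∀ s t, inner ℝ (P s) t = inner ℝ (P t) s)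
    (hQ : ∀ s t, inner ℝ (Q s) t = inner ℝ (Q t) s) (e : V ≃L[ℝ] V) {x ξ ξ' : V}
    (hξ : ∀ t, inner ℝ ξ (e t) = inner ℝ ξ' t) (f : 𝓢(V, ℂ)) :
    model P Q e (shift x ξ f) =
      shift (Q (e.symm (P ξ - x)) - ξ') (e.symm (x - P ξ)) (model P Q e f) := by
  rw [model, fourier_shift, chirpMul_shift hP, fourier_shift,
    dilation_shift e (x' := e.symm (-x + P ξ)) (ξ' := -ξ') (by simp) (by simpa using hξ),
    chirpMul_shift hQ, fourier_shift, model, ← map_neg, neg_add', neg_neg, neg_add_eq_sub,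
    neg_add_eq_sub]

theorem inner_toLp_model (P Q : V →L[ℝ] V) (e : V ≃L[ℝ] V) (f g : 𝓢(V, ℂ)) :
    inner ℂ ((model P Q e f).toLp 2 volume) ((model P Q e g).toLp 2 volume) =
      (|LinearMap.det (e : V →ₗ[ℝ] V)|⁻¹ : ℝ) *
        inner ℂ (f.toLp 2 volume) (g.toLp 2 volume) := by
  simp only [model, inner_toLp_fourier, inner_toLp_chirpMul, inner_toLp_dilation]

theorem integral_model_mul (P Q : V →L[ℝ] V) (e : V ≃L[ℝ] V) (f g : 𝓢(V, ℂ)) :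
    ∫ t, model P Q e f t * g t = ∫ u, ∫ v, phase (quad Q u) * phase (-(2 * inner ℝ v (e u))) *
      phase (quad P v) * ((𝓕 g : 𝓢(V, ℂ)) u * (𝓕 f : 𝓢(V, ℂ)) v) := by
  rw [model, SchwartzMap.integral_fourier_mul_eq]
  refine integral_congr_ae (.of_forall fun u => ?_)
  simp only [chirpMul_apply, dilation_apply]
  rw [SchwartzMap.fourier_coe (chirpMul P _), fourier_apply_eq, ← integral_const_mul,
    ← integral_mul_const]
  refine integral_congr_ae (.of_forall fun v => ?_)
  simp only [chirpMul_apply]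
  ring

end Model

/-! ### Matrices acting on Euclidean spaces -/

section Matrices

variable {n : Type*} [Fintype n] [DecidableEq n]

/-- The action of a matrix on a Euclidean space. -/
noncomputable abbrev act (M : Matrix n n ℝ) : EuclideanSpace ℝ n →L[ℝ] EuclideanSpace ℝ n :=
  Matrix.toEuclideanCLM (𝕜 := ℝ) M

theorem act_mul (M N : Matrix n n ℝ) (x : EuclideanSpace ℝ n) :
    act (M * N) x = act M (act N x) := by
  rw [act, map_mul]
  rfl

theorem act_one (x : EuclideanSpace ℝ n) : act 1 x = x := by
  rw [act, map_one]
  rfl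

theorem act_sub (M N : Matrix n n ℝ) (x : EuclideanSpace ℝ n) :
    act (M - N) x = act M x - act N x := by
  rw [act, map_sub]
  rfl

theorem act_neg (M : Matrix n n ℝ) (x : EuclideanSpace ℝ n) : act (-M) x = -act M x := by
  rw [act, map_neg]
  rfl

theorem inner_act_transpose (M : Matrix n n ℝ) (x y : EuclideanSpace ℝ n) :
    inner ℝ (act M.transpose x) y = inner ℝ x (act M y) := by
  rw [real_inner_comm, Matrix.inner_toEuclideanCLM, Matrix.inner_toEuclideanCLM,
    Matrix.mulVec_transpose, dotProduct_comm, Matrix.dotProduct_mulVec]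

theorem inner_act_of_isSymm {M : Matrix n n ℝ} (hM : M.transpose = M)
    (x y : EuclideanSpace ℝ n) : inner ℝ (act M x) y = inner ℝ (act M y) x := by
  rw [← hM, inner_act_transpose, hM, real_inner_comm]

/-- The linear automorphism `C⁻¹` for an invertible matrix `C`. -/
noncomputable def invEquiv {C : Matrix n n ℝ} (hC : IsUnit C) :
    EuclideanSpace ℝ n ≃L[ℝ] EuclideanSpace ℝ n :=
  ContinuousLinearEquiv.equivOfInverse (act C⁻¹) (act C)
    (fun x => by
      rw [← act_mul, Matrix.mul_nonsing_inv _ ((Matrix.isUnit_iff_isUnit_det C).mp hC), act_one])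
    (fun x => by
      rw [← act_mul, Matrix.nonsing_inv_mul _ ((Matrix.isUnit_iff_isUnit_det C).mp hC), act_one])

@[simp] theorem invEquiv_apply {C : Matrix n n ℝ} (hC : IsUnit C) (x : EuclideanSpace ℝ n) :
    invEquiv hC x = act C⁻¹ x := rfl

@[simp] theorem invEquiv_symm_apply {C : Matrix n n ℝ} (hC : IsUnit C)
    (x : EuclideanSpace ℝ n) : (invEquiv hC).symm x = act C x := rfl

theorem det_invEquiv {C : Matrix n n ℝ} (hC : IsUnit C) :
    LinearMap.det (invEquiv hC : EuclideanSpace ℝ n →ₗ[ℝ] EuclideanSpace ℝ n) = C.det⁻¹ := by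
  have h : (invEquiv hC : EuclideanSpace ℝ n →ₗ[ℝ] EuclideanSpace ℝ n) =
      Matrix.toLin (EuclideanSpace.basisFun n ℝ).toBasis (EuclideanSpace.basisFun n ℝ).toBasis
        C⁻¹ := by
    rw [← Matrix.toEuclideanLin_eq_toLin_orthonormal]
    rfl
  rw [h, LinearMap.det_toLin, Matrix.det_nonsing_inv, Ring.inverse_eq_inv']

end Matrices

theorem fromBlocks_toEuclideanLin_pair (A B C D : Matrix (Fin d) (Fin d) ℝ) (x y : Rd d) :
    (Matrix.fromBlocks A B C D).toEuclideanLin (pair x y) =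
      pair (act A x + act B y) (act C x + act D y) := by
  ext i
  cases i <;> simp [pair, Matrix.fromBlocks_mulVec]

theorem inner_pair (x y x' y' : Rd d) :
    inner ℝ (pair x y) (pair x' y') = inner ℝ x x' + inner ℝ y y' := by
  simp [pair, PiLp.inner_apply]

/-! ### Metaplectic operators with invertible lower left block -/

section Block

variable {A B C D : Matrix (Fin d) (Fin d) ℝ}

theorem transpose_mul_inv_of_symplectic
    (hS : Matrix.fromBlocks A B C D ∈ Matrix.symplecticGroup (Fin d) ℝ) (hC : IsUnit C) :
    (A * C⁻¹).transpose = A * C⁻¹ := by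
  have hdet := (Matrix.isUnit_iff_isUnit_det C).mp hC
  have h1 := (SymplecticGroup.fromBlocks_mem_iff.mp hS).1
  have hdet' : IsUnit C.transpose.det := by rwa [Matrix.det_transpose]
  rw [Matrix.transpose_mul, Matrix.transpose_nonsing_inv]
  calc C.transpose⁻¹ * A.transpose = C.transpose⁻¹ * (A.transpose * C) * C⁻¹ := by
        rw [← Matrix.mul_assoc, Matrix.mul_nonsing_inv_cancel_right _ _ hdet]
    _ = A * C⁻¹ := by rw [h1, Matrix.nonsing_inv_mul_cancel_left _ _ hdet']

/-- The needed relation C Dᵀ = D Cᵀ is a block identity for the transpose of S, which is again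
symplectic. -/
theorem transpose_inv_mul_of_symplectic
    (hS : Matrix.fromBlocks A B C D ∈ Matrix.symplecticGroup (Fin d) ℝ) (hC : IsUnit C) :
    (C⁻¹ * D).transpose = C⁻¹ * D := by
  have hdet := (Matrix.isUnit_iff_isUnit_det C).mp hC
  have h1 := SymplecticGroup.transpose_mem hS
  rw [Matrix.fromBlocks_transpose] at h1
  have h2 := (SymplecticGroup.fromBlocks_mem_iff.mp h1).2.1
  simp only [Matrix.transpose_transpose] at h2
  have hdet' : IsUnit C.transpose.det := by rwa [Matrix.det_transpose]
  rw [Matrix.transpose_mul, Matrix.transpose_nonsing_inv]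
  calc D.transpose * C.transpose⁻¹ = C⁻¹ * (C * D.transpose) * C.transpose⁻¹ := by
        rw [Matrix.nonsing_inv_mul_cancel_left _ _ hdet]
    _ = C⁻¹ * D := by
        rw [h2, Matrix.mul_assoc, Matrix.mul_nonsing_inv_cancel_right _ _ hdet']

theorem eq_sub_of_symplectic
    (hS : Matrix.fromBlocks A B C D ∈ Matrix.symplecticGroup (Fin d) ℝ) (hC : IsUnit C) :
    B = A * C⁻¹ * D - C⁻¹.transpose := by
  have h1 := (SymplecticGroup.fromBlocks_mem_iff.mp hS).2.2
  have hdet := (Matrix.isUnit_iff_isUnit_det C).mp hC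
  have hdet' : IsUnit C.transpose.det := by rwa [Matrix.det_transpose]
  have h2 : C.transpose * B = A.transpose * D - 1 := by rw [← h1]; abel
  rw [← transpose_mul_inv_of_symplectic hS hC, Matrix.transpose_mul, Matrix.transpose_nonsing_inv,
    Matrix.mul_assoc, ← Matrix.nonsing_inv_mul_cancel_left C.transpose B hdet', h2,
    Matrix.mul_sub, Matrix.mul_one]

/-- The model operator attached to `S = (A B; C D)`, up to a positive factor. -/
noncomputable abbrev blockModel (A D : Matrix (Fin d) (Fin d) ℝ) (hC : IsUnit C)
    (f : 𝓢(Rd d, ℂ)) : 𝓢(Rd d, ℂ) :=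
  model (act (-(C⁻¹ * D))) (act (-(A * C⁻¹))) (invEquiv hC) f

theorem blockModel_shift
    (hS : Matrix.fromBlocks A B C D ∈ Matrix.symplecticGroup (Fin d) ℝ) (hC : IsUnit C)
    (x ξ : Rd d) (f : 𝓢(Rd d, ℂ)) :
    blockModel A D hC (shift x ξ f) =
      shift (act A x + act B ξ) (act C x + act D ξ) (blockModel A D hC f) := by
  have hdet := (Matrix.isUnit_iff_isUnit_det C).mp hC
  have hCD : ∀ y : Rd d, act C (act (C⁻¹ * D) y) = act D y := fun y => by
    rw [← act_mul, Matrix.mul_nonsing_inv_cancel_left _ _ hdet]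
  have h := model_shift (P := act (-(C⁻¹ * D))) (Q := act (-(A * C⁻¹)))
    (inner_act_of_isSymm (by rw [Matrix.transpose_neg, transpose_inv_mul_of_symplectic hS hC]))
    (inner_act_of_isSymm (by rw [Matrix.transpose_neg, transpose_mul_inv_of_symplectic hS hC]))
    (invEquiv hC) (x := x) (ξ := ξ) (ξ' := act C⁻¹.transpose ξ)
    (fun t => by rw [invEquiv_apply, inner_act_transpose]) f
  rw [blockModel, h]
  congr 1
  · congr 1
    · have h1 : act (A * C⁻¹) (act C x) = act A x := by
        rw [← act_mul, Matrix.nonsing_inv_mul_cancel_right _ _ hdet]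
      rw [eq_sub_of_symplectic hS hC, act_sub, act_mul (A * C⁻¹) D]
      simp only [invEquiv_symm_apply, act_neg]
      simp only [map_sub, map_neg, hCD, h1]
      abel
    · simp only [invEquiv_symm_apply, act_neg]
      simp only [sub_neg_eq_add, map_add, hCD]

theorem symm_schrodinger {T : L2 d ≃ₗᵢ[ℂ] L2 d}
    (hT : IsMetaplectic (Matrix.fromBlocks A B C D) T) (x ξ : Rd d) (f : L2 d) :
    T.symm (schrodinger (pair (act A x + act B ξ) (act C x + act D ξ)) 0 f) =
      schrodinger (pair x ξ) 0 (T.symm f) := by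
  rw [← fromBlocks_toEuclideanLin_pair, ← hT.intertwines, LinearIsometryEquiv.symm_apply_apply]

theorem schrodinger_smul (x ξ : Rd d) (c : ℂ) (f : L2 d) :
    schrodinger (pair x ξ) 0 (c • f) = c • schrodinger (pair x ξ) 0 f := by
  refine Lp.ext ?_
  have h1 := (measurePreserving_sub_right (volume : Measure (Rd d)) x).quasiMeasurePreserving.ae
    (Lp.coeFn_smul c f)
  filter_upwards [schrodinger_pair_ae x ξ (c • f), schrodinger_pair_ae x ξ f, h1,
    Lp.coeFn_smul c (schrodinger (pair x ξ) 0 f)] with t h2 h3 h4 h5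
  rw [h2, h4, h5, Pi.smul_apply, Pi.smul_apply, h3, smul_eq_mul, smul_eq_mul]
  ring

/-- A metaplectic operator with invertible block `C` agrees with the model operator on Schwartz
functions, up to a phase. -/
theorem exists_apply_toLp_eq {T : L2 d ≃ₗᵢ[ℂ] L2 d}
    (hT : IsMetaplectic (Matrix.fromBlocks A B C D) T) (hC : IsUnit C) :
    ∃ c : ℂ, ‖c‖ = 1 ∧ ∀ f : 𝓢(Rd d, ℂ), T (f.toLp 2 volume) =
      (c * ((|C.det| ^ (-(1 / 2) : ℝ) : ℝ) : ℂ)) • (blockModel A D hC f).toLp 2 volume := by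
  set κ : ℝ := |C.det| ^ (-(1 / 2) : ℝ)
  have hdet : 0 < |C.det| := abs_pos.mpr ((Matrix.isUnit_iff_isUnit_det C).mp hC).ne_zero
  -- The model multiplies inner products by |det C|, so κ is chosen to normalise it to an isometry.
  have hκ : κ * κ * |C.det| = 1 := by
    simp only [κ]
    rw [← Real.rpow_add hdet, ← Real.rpow_add_one hdet.ne']
    norm_num
  -- T⁻¹ undoes the action of S on shifts produced by the model, so the composite commutes with the
  -- representation and Schur's lemma applies; then c = γ⁻¹.
  obtain ⟨γ, hγ, h⟩ := exists_eq_smul_of_commute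
    (fun f => T.symm ((κ : ℂ) • (blockModel A D hC f).toLp 2 volume))
    (fun f g => by
      rw [LinearIsometryEquiv.inner_map_map, inner_smul_left, inner_smul_right, inner_toLp_model,
        det_invEquiv, abs_inv, inv_inv, Complex.conj_ofReal, ← mul_assoc, ← mul_assoc]
      rw [← Complex.ofReal_mul, ← Complex.ofReal_mul, hκ, Complex.ofReal_one, one_mul])
    (fun x ξ f => by
      rw [blockModel_shift hT.symplectic, ← schrodinger_toLp, ← schrodinger_smul,
        symm_schrodinger hT])
  have hγ0 : γ ≠ 0 := by
    rintro rfl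
    simp at hγ
  refine ⟨γ⁻¹, by simp [hγ], fun f => ?_⟩
  have h1 := congrArg T (h f)
  rw [LinearIsometryEquiv.apply_symm_apply, map_smul] at h1
  rw [mul_smul, h1, smul_smul, inv_mul_cancel₀ hγ0, one_smul]

end Block

/-! ### Integration over `ℝ^{2d} = ℝ^d × ℝ^d` -/

theorem measurePreserving_pair :
    MeasurePreserving (fun p : Rd d × Rd d => pair p.1 p.2)
      ((volume : Measure (Rd d)).prod volume) volume := by
  have h1 := (PiLp.volume_preserving_ofLp (Fin d)).prod (PiLp.volume_preserving_ofLp (Fin d))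
  have h2 := (measurePreserving_sumPiEquivProdPi
    (fun _ : Fin d ⊕ Fin d => (volume : Measure ℝ))).symm
  exact (PiLp.volume_preserving_toLp (Fin d ⊕ Fin d)).comp (h2.comp h1)

theorem pair_fstL_sndL (z : R2d d) : pair (fstL d z) (sndL d z) = z := by
  ext i
  cases i <;> rfl

theorem measurableEmbedding_pair :
    MeasurableEmbedding (fun p : Rd d × Rd d => pair p.1 p.2) := by
  -- An injective Borel map between standard Borel spaces is a measurable embedding, so injectivity
  -- is all that is left.
  refine (Measurable.measurableEmbedding measurePreserving_pair.measurable ?_)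
  intro p q h
  exact Prod.ext (congrArg (fstL d) h) (congrArg (sndL d) h)

theorem integral_pair_prod (F : R2d d → ℂ) :
    ∫ w, F w = ∫ p : Rd d × Rd d, F (pair p.1 p.2) ∂((volume : Measure (Rd d)).prod volume) :=
  (measurePreserving_pair.integral_comp measurableEmbedding_pair F).symm

theorem integral_pair {F : R2d d → ℂ} (hF : Integrable F) :
    ∫ w, F w = ∫ u, ∫ v, F (pair u v) := by
  rw [integral_pair_prod, integral_prod]
  exact measurePreserving_pair.integrable_comp_of_integrable hF

theorem inner_eq_fstL_sndL (w z : R2d d) :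
    inner ℝ w z = inner ℝ (fstL d w) (fstL d z) + inner ℝ (sndL d w) (sndL d z) := by
  rw [← inner_pair, pair_fstL_sndL, pair_fstL_sndL]

theorem fourier_tensor (g f : 𝓢(Rd d, ℂ)) : 𝓕 (tensor g f) = tensor (𝓕 g) (𝓕 f) := by
  ext w
  rw [tensor_apply, SchwartzMap.fourier_coe, SchwartzMap.fourier_coe, SchwartzMap.fourier_coe,
    fourier_apply_eq, fourier_apply_eq, fourier_apply_eq, integral_pair_prod, ← integral_prod_mul]
  refine integral_congr_ae (.of_forall fun p => ?_)
  simp only [tensor_apply, fstL_pair, sndL_pair, inner_eq_fstL_sndL _ w, mul_add, neg_add,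
    phase_add]
  ring

/-! ### The kernel -/

theorem chirp_eq_phase (M : Matrix (Fin d ⊕ Fin d) (Fin d ⊕ Fin d) ℝ) (w : R2d d) :
    chirp M w = phase (quad (act M) w) := rfl

/-- The off-diagonal blocks of S̃ are transposes of each other, so each contributes C⁻¹u·v; this
yields the factor 2 that makes the middle term a Fourier exponential. The result matches the
integrand of `integral_model_mul`. -/
theorem chirp_neg_chirpMatrix_pair (A C D : Matrix (Fin d) (Fin d) ℝ) (u v : Rd d) :
    chirp (-chirpMatrix A C D) (pair u v) =
      phase (quad (act (-(A * C⁻¹))) u) * phase (-(2 * inner ℝ v (act C⁻¹ u))) *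
        phase (quad (act (-(C⁻¹ * D))) v) := by
  have h : act (-chirpMatrix A C D) (pair u v) =
      pair (-(act (A * C⁻¹) u + act C⁻¹.transpose v)) (-(act C⁻¹ u + act (C⁻¹ * D) v)) := by
    rw [act_neg]
    refine (congrArg Neg.neg (fromBlocks_toEuclideanLin_pair _ _ _ _ u v)).trans ?_
    ext i
    cases i <;> rfl
  rw [chirp_eq_phase, ← phase_add, ← phase_add]
  congr 1
  rw [quad, quad, quad, h, inner_pair, act_neg, act_neg]
  simp only [inner_neg_left, inner_add_left, inner_act_transpose, real_inner_comm v (act C⁻¹ u)]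
  ring

theorem integrable_mul_chirp (M : Matrix (Fin d ⊕ Fin d) (Fin d ⊕ Fin d) ℝ) (h : 𝓢(R2d d, ℂ)) :
    Integrable fun w => h w * chirp M w := by
  refine ((chirpMul (act M) h).integrable (μ := volume)).congr (.of_forall fun w => ?_)
  simp only [chirpMul_apply, chirp_eq_phase, mul_comm]

theorem fourier_chirpDistribution_apply (M : Matrix (Fin d ⊕ Fin d) (Fin d ⊕ Fin d) ℝ)
    (h : 𝓢(R2d d, ℂ)) :
    𝓕 (chirpDistribution M) h = ∫ w, (𝓕 h : 𝓢(R2d d, ℂ)) w * chirp M w := by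
  rw [TemperedDistribution.fourier_apply, chirpDistribution, Lp.toTemperedDistribution_apply]
  refine integral_congr_ae ?_
  filter_upwards [(memLp_chirp M).coeFn_toLp] with w hw
  rw [hw, smul_eq_mul]

theorem fourier_chirpDistribution_tensor (A D : Matrix (Fin d) (Fin d) ℝ)
    {C : Matrix (Fin d) (Fin d) ℝ} (hC : IsUnit C) (f g : 𝓢(Rd d, ℂ)) :
    𝓕 (chirpDistribution (-chirpMatrix A C D)) (tensor g f) =
      ∫ t, blockModel A D hC f t * g t := by
  rw [fourier_chirpDistribution_apply, integral_pair (integrable_mul_chirp _ _), fourier_tensor,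
    blockModel, integral_model_mul]
  simp only [chirp_neg_chirpMatrix_pair, tensor_apply, fstL_pair, sndL_pair, invEquiv_apply]
  refine integral_congr_ae (.of_forall fun u => integral_congr_ae (.of_forall fun v => ?_))
  ring

theorem isSchwartzKernel_of_apply_toLp_eq (A D : Matrix (Fin d) (Fin d) ℝ)
    {C : Matrix (Fin d) (Fin d) ℝ} (hC : IsUnit C) {T : L2 d ≃ₗᵢ[ℂ] L2 d} {b : ℂ}
    (hT : ∀ f : 𝓢(Rd d, ℂ), T (f.toLp 2 volume) = b • (blockModel A D hC f).toLp 2 volume) :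
    IsSchwartzKernel (onSchwartz T) (b • 𝓕 (chirpDistribution (-chirpMatrix A C D))) := by
  intro f g
  change _ = b • 𝓕 (chirpDistribution (-chirpMatrix A C D)) (tensor g f)
  rw [fourier_chirpDistribution_tensor A D hC, onSchwartz, Lp.toTemperedDistribution_apply, hT,
    smul_eq_mul, ← integral_const_mul]
  refine integral_congr_ae ?_
  filter_upwards [Lp.coeFn_smul b ((blockModel A D hC f).toLp 2 volume),
    (blockModel A D hC f).coeFn_toLp 2 volume] with t h1 h2
  rw [h1, Pi.smul_apply, h2, smul_eq_mul, smul_eq_mul]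
  ring

/-! ### The smoothed kernel -/

/-- The point where the Gaussian window matters: its translates are elementary tensors, the only
test functions on which the kernel identity gives direct information. -/
theorem reflectTranslate_gaussian (z : R2d d) :
    reflectTranslate (gaussian (R2d d)) z =
      tensor (reflectTranslate (gaussian (Rd d)) (fstL d z))
        (reflectTranslate (gaussian (Rd d)) (sndL d z)) := by
  ext w
  simp only [reflectTranslate_apply, tensor_apply, gaussian_apply, ← Complex.ofReal_mul,
    ← Real.exp_add, norm_sq_eq (z - w), map_sub, mul_add]

theorem fourier_gaussian (V : Type*) [NormedAddCommGroup V] [InnerProductSpace ℝ V]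
    [FiniteDimensional ℝ V] [MeasurableSpace V] [BorelSpace V] (w : V) :
    𝓕 (gaussian V : V → ℂ) w = gaussian V w := by
  have h := fourier_gaussian_innerProductSpace (V := V) (b := (Real.pi : ℂ))
    (by simpa using Real.pi_pos) w
  have hpi : (Real.pi : ℂ) ≠ 0 := by exact_mod_cast Real.pi_ne_zero
  rw [div_self hpi, Complex.one_cpow, one_mul] at h
  have h1 : (gaussian V : V → ℂ) = fun v => Complex.exp (-(Real.pi : ℂ) * (‖v‖ : ℂ) ^ 2) := by
    ext v
    simp
  rw [h1, h]
  congr 1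
  field_simp

/-- Translation by z becomes modulation, reflection is harmless because φ is even, and 𝓕φ = φ. The
modulation is the exponential of a Fourier integral evaluated at z, which is how 𝓕(Φ_M φ)(z) arises.
-/
theorem fourier_reflectTranslate_gaussian (z w : R2d d) :
    (𝓕 (reflectTranslate (gaussian (R2d d)) z) : 𝓢(R2d d, ℂ)) w =
      phase (-(2 * inner ℝ w z)) * gaussian (R2d d) w := by
  have h1 : gaussian (R2d d) w = gaussian (R2d d) (-w) := by simp
  rw [h1, ← fourier_gaussian, SchwartzMap.fourier_coe, fourier_apply_eq, fourier_apply_eq,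
    ← integral_sub_left_eq_self _ volume z, ← integral_const_mul]
  refine integral_congr_ae (.of_forall fun t => ?_)
  simp only [reflectTranslate_apply, sub_sub_cancel, ← mul_assoc, ← phase_add]
  congr 2
  rw [inner_sub_left, inner_neg_right, real_inner_comm w z]
  ring

theorem fourier_chirpDistribution_reflectTranslate
    (M : Matrix (Fin d ⊕ Fin d) (Fin d ⊕ Fin d) ℝ) (z : R2d d) :
    𝓕 (chirpDistribution M) (reflectTranslate (gaussian (R2d d)) z) =
      𝓕 (fun w : R2d d => chirp M w * gaussian (R2d d) w) z := by
  rw [fourier_chirpDistribution_apply, fourier_apply_eq]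
  refine integral_congr_ae (.of_forall fun w => ?_)
  simp only [fourier_reflectTranslate_gaussian]
  ring

/-- The smoothed kernel depends on the operator only. -/
theorem smoothedKernel_eq_of_isSchwartzKernel {T : 𝓢(Rd d, ℂ) → 𝓢'(Rd d, ℂ)}
    {k k' : 𝓢'(R2d d, ℂ)} (hk : IsSchwartzKernel T k) (hk' : IsSchwartzKernel T k') (z : R2d d) :
    smoothedKernel k z = smoothedKernel k' z := by
  rw [smoothedKernel, smoothedKernel, convolve, convolve, reflectTranslate_gaussian, ← hk, ← hk']

theorem isDiagonalKernel_schwartz (ψ : 𝓢(R2d d, ℂ)) : IsDiagonalKernel ψ := by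
  refine ⟨ψ.continuous, fun N _ => ?_⟩
  set M := 2 ^ N * (Finset.Iic (N, 0)).sup (fun m => SchwartzMap.seminorm ℝ m.1 m.2) ψ
  have hM : ∀ z, (1 + ‖z‖) ^ N * ‖ψ z‖ ≤ M := fun z => by
    simpa using SchwartzMap.one_add_le_sup_seminorm_apply (𝕜 := ℝ) (m := (N, 0)) le_rfl le_rfl ψ z
  have hM0 : 0 ≤ M := by positivity
  -- The factor 2^N comes from ⟨x - y⟩ ≤ 2(1 + |(x,y)|); adding 1 keeps the constant positive when M
  -- = 0.
  refine ⟨2 ^ N * M + 1, by positivity, fun x y => ?_⟩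
  have hb : 0 < bracket (x - y) := Real.sqrt_pos.mpr (by positivity)
  rw [← div_eq_mul_inv, le_div_iff₀ (by positivity)]
  have h1 : ‖x - y‖ ≤ 2 * ‖pair x y‖ := by
    have hx : ‖x‖ ≤ ‖pair x y‖ := by
      simpa using (fstL d).le_of_opNorm_le norm_fstL_le (pair x y)
    have hy : ‖y‖ ≤ ‖pair x y‖ := by
      simpa using (sndL d).le_of_opNorm_le norm_sndL_le (pair x y)
    linarith [norm_sub_le x y]
  have h2 : bracket (x - y) ≤ 2 * (1 + ‖pair x y‖) := by
    refine Real.sqrt_le_iff.mpr ⟨by positivity, ?_⟩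
    nlinarith [norm_nonneg (x - y), norm_nonneg (pair x y)]
  calc ‖ψ (pair x y)‖ * bracket (x - y) ^ N
      ≤ ‖ψ (pair x y)‖ * (2 * (1 + ‖pair x y‖)) ^ N := by gcongr
    _ = 2 ^ N * ((1 + ‖pair x y‖) ^ N * ‖ψ (pair x y)‖) := by rw [mul_pow]; ring
    _ ≤ 2 ^ N * M := by gcongr; exact hM _
    _ ≤ 2 ^ N * M + 1 := by linarith

end Metaplectic

/-! ### The kernel formula and quasi-diagonality. -/

theorem proposition3p2 (d : ℕ) (A B C D : Matrix (Fin d) (Fin d) ℝ)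
    (T : Metaplectic.L2 d ≃ₗᵢ[ℂ] Metaplectic.L2 d)
    (hT : Metaplectic.IsMetaplectic (Matrix.fromBlocks A B C D) T) (hC : IsUnit C) :
    ∃ c : ℂ, ‖c‖ = 1 ∧
      Metaplectic.IsSchwartzKernel (Metaplectic.onSchwartz T)
        ((c * ((|C.det| ^ (-(1 / 2) : ℝ) : ℝ) : ℂ)) •
          𝓕 (Metaplectic.chirpDistribution (-Metaplectic.chirpMatrix A C D))) ∧
      ∀ k : 𝓢'(Metaplectic.R2d d, ℂ),
        Metaplectic.IsSchwartzKernel (Metaplectic.onSchwartz T) k →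
          (∀ z, Metaplectic.smoothedKernel k z = c * ((|C.det| ^ (-(1 / 2) : ℝ) : ℝ) : ℂ) *
            𝓕 (fun w : Metaplectic.R2d d =>
              Metaplectic.chirp (-Metaplectic.chirpMatrix A C D) w *
                Metaplectic.gaussian (Metaplectic.R2d d) w) z) ∧
          (∃ ψ : 𝓢(Metaplectic.R2d d, ℂ), ∀ z, ψ z = Metaplectic.smoothedKernel k z) ∧
          Metaplectic.IsQuasiDiagonal k := by
  obtain ⟨c, hc, hTf⟩ := Metaplectic.exists_apply_toLp_eq hT hC
  have hker := Metaplectic.isSchwartzKernel_of_apply_toLp_eq A D hC hTf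
  set M := -Metaplectic.chirpMatrix A C D
  set b : ℂ := c * ((|C.det| ^ (-(1 / 2) : ℝ) : ℝ) : ℂ)
  refine ⟨c, hc, hker, fun k hk => ?_⟩
  have h1 : ∀ z, Metaplectic.smoothedKernel k z = b * 𝓕 (fun w : Metaplectic.R2d d =>
      Metaplectic.chirp M w * Metaplectic.gaussian (Metaplectic.R2d d) w) z := fun z => by
    rw [Metaplectic.smoothedKernel_eq_of_isSchwartzKernel hk hker,
      ← Metaplectic.fourier_chirpDistribution_reflectTranslate]
    rfl
  obtain ⟨ψ, hψ⟩ : ∃ ψ : 𝓢(Metaplectic.R2d d, ℂ), ∀ z, ψ z = Metaplectic.smoothedKernel k z := by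
    -- Chirps have temperate growth, so Φ_M φ is Schwartz, and so is its Fourier transform.
    refine ⟨b • 𝓕 (Metaplectic.chirpMul (Metaplectic.act M)
      (Metaplectic.gaussian (Metaplectic.R2d d))), fun z => ?_⟩
    rw [h1, smul_apply, SchwartzMap.fourier_coe, smul_eq_mul]
    have hfun : (Metaplectic.chirpMul (Metaplectic.act M)
        (Metaplectic.gaussian (Metaplectic.R2d d)) : Metaplectic.R2d d → ℂ) =
        fun w => Metaplectic.chirp M w * Metaplectic.gaussian (Metaplectic.R2d d) w := by
      ext w
      rw [Metaplectic.chirpMul_apply, Metaplectic.chirp_eq_phase]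
    rw [hfun]
  refine ⟨h1, ⟨ψ, hψ⟩, ?_⟩
  rw [Metaplectic.IsQuasiDiagonal, ← funext hψ]
  exact Metaplectic.isDiagonalKernel_schwartz ψ
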